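/- Proposition 1. Let $f=f^{(a)}:\mathbb R^d\times\mathbb R^d\times\mathbb R\times\mathbb R^p\to\mathbb R^d$ be $C^1$, and let $\theta_f\in\mathbb R^p$, $\theta_g\in\mathbb R^q$, $\theta_s\in\mathbb R^k$ be time-independent parameters such that $(x,v,t)\mapsto\frac{\partial f}{\partial \dot x}(x,v,t,\theta_f)$ (the Jacobian in the second argument) is $C^1$. Let $t_0<t_n$, let $X_0$ be fixed input data, and suppose that for all parameters in a neighbourhood of $(\theta_f,\theta_g,\theta_s)$ the second order neural ODE (SONODE) $$\ddot x=f(x,\dot x,t,\theta_f),\qquad x(t_0)=s(X_0,\theta_s),\qquad \dot x(t_0)=g(x(t_0),\theta_g)$$ has a solution on $[t_0,t_n]$. Let $L=L(x(t_n),\dot x(t_n))\in\mathbb R$ be the loss. Let $x$ be the solution at the given parameters, and suppose that $L$ is differentiable at $(x(t_n),\dot x(t_n))$, $g$ at $(x(t_0),\theta_g)$ and $s(X_0,\cdot)$ at $\theta_s$. Partial derivatives of $f$ below are taken along $x$, i.e. at $(x(t),\dot x(t),t,\theta_f)$. Those of $L$ are taken at $(x(t_n),\dot x(t_n))$ and those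 of $g$ at $(x(t_0),\theta_g)$, and $\frac{d}{dt}$ is the total time derivative along $x$. The adjoint state $r$ is defined on $[t_0,t_n]$ by $$r(t)^T=-\frac{\partial L}{\partial x(t_n)^T}A(t)-\frac{\partial L}{\partial \dot x(t_n)^T}B(t),$$ where the $d\times d$ matrix functions $A$ and $B$ both solve $\ddot M=M\frac{\partial f}{\partial x}-\frac{d}{dt}\bigl(M\frac{\partial f}{\partial\dot x}\bigr)$ on $[t_0,t_n]$, with $A(t_n)=0$, $\dot A(t_n)=I$, $B(t_n)=-I$, $\dot B(t_n)=\frac{\partial f}{\partial\dot x}\big|_{t_n}$. Then such an $r$ exists, and it is the unique solution on $[t_0,t_n]$ of the linear second order ODE $$\ddot r^T=r^T\frac{\partial f}{\partial x}-\dot r^T\frac{\partial f}{\partial\dot x}-r^T\frac{d}{dt}\Bigl(\frac{\partial f}{\partial\dot x}\Bigr),\qquad \frac{d}{dt}\Bigl(\frac{\partial f}{\partial\dot x}\Bigr)=\Bigl(\sum_i\dot x_i\partial_{x_i}+\sum_i f_i\,\partial_{\dot x_i}+\partial_t\Bigr)\frac{\partial f}{\partial\dot x},$$ with the terminal conditions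 $$r(t_n)^T=\frac{\partial L}{\partial\dot x(t_n)^T},\qquad \dot r(t_n)^T=-\frac{\partial L}{\partial x(t_n)^T}-\frac{\partial L}{\partial\dot x(t_n)^T}\frac{\partial f}{\partial\dot x}\Big|_{t_n}.$$ Moreover, the loss is differentiable in each of $\theta_f$, $\theta_g$, $\theta_s$ (the other two being fixed) at the given parameters, and $$\frac{dL}{d\theta_f}=-\int_{t_n}^{t_0}r(t)^T\frac{\partial f}{\partial\theta_f}\,dt,\qquad \frac{dL}{d\theta_g}=r(t_0)^T\frac{\partial g}{\partial\theta_g},$$ $$\frac{dL}{d\theta_s}=\Bigl(r(t_0)^T\frac{\partial g}{\partial x(t_0)^T}-\dot r(t_0)^T-r(t_0)^T\frac{\partial f}{\partial\dot x}\Big|_{t_0}\Bigr)\frac{d s(X_0,\theta_s)}{d\theta_s}.$$ -/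

import Mathlib

open Set Filter Topology

namespace SONODE

variable {E P Q S D : Type*}
  [NormedAddCommGroup E] [NormedSpace ℝ E] [NormedAddCommGroup P] [NormedSpace ℝ P]

/-- `x` is the trajectory on `[t₀, tₙ]`, with velocity `v`, of the second order neural ODE
`x'' = f(x, x', t, θf)`, `x(t₀) = s(X₀, θs)`, `x'(t₀) = g(x(t₀), θg)`.
Derivatives at the end points are one-sided. -/
structure IsTrajectory (f : E → E → ℝ → P → E) (g : E → Q → E) (s : D → S → E) (X₀ : D)
    (t₀ tₙ : ℝ) (θf : P) (θg : Q) (θs : S) (x v : ℝ → E) : Prop where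
  velocity : ∀ t ∈ Icc t₀ tₙ, HasDerivWithinAt x (v t) (Icc t₀ tₙ) t
  acceleration : ∀ t ∈ Icc t₀ tₙ, HasDerivWithinAt v (f (x t) (v t) t θf) (Icc t₀ tₙ) t
  initial_position : x t₀ = s X₀ θs
  initial_velocity : v t₀ = g (x t₀) θg

/-- The Jacobian `∂f/∂x` along the curve `(x, v)`, as a function of time. -/
noncomputable def jacX (f : E → E → ℝ → P → E) (θf : P) (x v : ℝ → E) (t : ℝ) : E →L[ℝ] E :=
  fderiv ℝ (fun y => f y (v t) t θf) (x t)

/-- The Jacobian `∂f/∂x'` along the curve `(x, v)`, as a function of time. -/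
noncomputable def jacV (f : E → E → ℝ → P → E) (θf : P) (x v : ℝ → E) (t : ℝ) : E →L[ℝ] E :=
  fderiv ℝ (fun w => f (x t) w t θf) (v t)

/-- The Jacobian `∂f/∂θf` along the curve `(x, v)`, as a function of time. -/
noncomputable def jacθ (f : E → E → ℝ → P → E) (θf : P) (x v : ℝ → E) (t : ℝ) : P →L[ℝ] E :=
  fderiv ℝ (fun θ => f (x t) (v t) t θ) θf

/-- The row vector `∂L/∂x(tₙ)`. Row vectors are linear functionals on the state space. -/
noncomputable def lossX (L : E → E → ℝ) (x v : ℝ → E) (tₙ : ℝ) : E →L[ℝ] ℝ :=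
  fderiv ℝ (fun y => L y (v tₙ)) (x tₙ)

/-- The row vector `∂L/∂x'(tₙ)`. -/
noncomputable def lossV (L : E → E → ℝ) (x v : ℝ → E) (tₙ : ℝ) : E →L[ℝ] ℝ :=
  fderiv ℝ (fun w => L (x tₙ) w) (v tₙ)

/-- The matrix-valued multiplier `A`, with derivative `A'`, follows on `[t₀, tₙ]` the second order
ODE `A'' = A ∂f/∂x - d/dt (A ∂f/∂x')`. -/
structure IsMultiplier (f : E → E → ℝ → P → E) (t₀ tₙ : ℝ) (θf : P) (x v : ℝ → E)
    (A A' : ℝ → E →L[ℝ] E) : Prop where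
  deriv_one : ∀ t ∈ Icc t₀ tₙ, HasDerivWithinAt A (A' t) (Icc t₀ tₙ) t
  deriv_two : ∀ t ∈ Icc t₀ tₙ, HasDerivWithinAt A'
    ((A t).comp (jacX f θf x v t)
      - derivWithin (fun τ => (A τ).comp (jacV f θf x v τ)) (Icc t₀ tₙ) t) (Icc t₀ tₙ) t

/-- The (transposed) adjoint state `rᵀ = -(∂L/∂x(tₙ)) A - (∂L/∂x'(tₙ)) B` on `[t₀, tₙ]`: the sum of
the adjoint of the position, whose multiplier `A` has `A(tₙ) = 0`, `A'(tₙ) = I`, and of the adjoint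
of the velocity, whose multiplier `B` has `B(tₙ) = -I`, `B'(tₙ) = ∂f/∂x'` at `tₙ`. -/
def IsAdjointState (f : E → E → ℝ → P → E) (L : E → E → ℝ) (t₀ tₙ : ℝ) (θf : P) (x v : ℝ → E)
    (r : ℝ → E →L[ℝ] ℝ) : Prop :=
  ∃ A A' B B' : ℝ → E →L[ℝ] E,
    IsMultiplier f t₀ tₙ θf x v A A' ∧ A tₙ = 0 ∧ A' tₙ = ContinuousLinearMap.id ℝ E ∧
    IsMultiplier f t₀ tₙ θf x v B B' ∧ B tₙ = -ContinuousLinearMap.id ℝ E ∧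
      B' tₙ = jacV f θf x v tₙ ∧
    ∀ t ∈ Icc t₀ tₙ, r t = -(lossX L x v tₙ).comp (A t) - (lossV L x v tₙ).comp (B t)

/-- `r`, with derivative `r'`, solves on `[t₀, tₙ]` the linear terminal value problem
`r'' = rᵀ ∂f/∂x - r'ᵀ ∂f/∂x' - rᵀ d/dt(∂f/∂x')`, `r(tₙ) = ∂L/∂x'(tₙ)`,
`r'(tₙ) = -∂L/∂x(tₙ) - ∂L/∂x'(tₙ) ∂f/∂x'`. -/
structure SolvesAdjointProblem (f : E → E → ℝ → P → E) (L : E → E → ℝ) (t₀ tₙ : ℝ) (θf : P)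
    (x v : ℝ → E) (r r' : ℝ → E →L[ℝ] ℝ) : Prop where
  deriv_one : ∀ t ∈ Icc t₀ tₙ, HasDerivWithinAt r (r' t) (Icc t₀ tₙ) t
  deriv_two : ∀ t ∈ Icc t₀ tₙ, HasDerivWithinAt r'
    ((r t).comp (jacX f θf x v t) - (r' t).comp (jacV f θf x v t)
      - (r t).comp (derivWithin (jacV f θf x v) (Icc t₀ tₙ) t)) (Icc t₀ tₙ) t
  terminal_value : r tₙ = lossV L x v tₙ
  terminal_deriv : r' tₙ = -lossX L x v tₙ - (lossV L x v tₙ).comp (jacV f θf x v tₙ)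

end SONODE

/-!
The loss gradients rest on the duality between a linearised ODE and its adjoint. Written as a first
order autonomous system for `z = (x, x', t, θ)`, with field `F = (x', f, 1, 0)`, the ODE has the
costate equation `p' = -p DF(z)`. If `z` and `z̃` are two trajectories, then `p (z̃ - z)` has
derivative `p (F z̃ - F z - DF(z) (z̃ - z))`, which is of lower order than `z̃ - z` uniformly in time,
because `F` is `C¹` and the trajectory is compact. With `p` equal to the derivative of the loss at
the final time, the change of the loss is therefore `p` at the initial time applied to the change of
the initial data, up to lower order (`hasFDerivAt_endpoint_of_costate`). For this, `z̃ - z`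
has to be bounded by the parameter increment (`exists_eventually_norm_trajectory_sub_le`).

The costate has components `-(r' + r ∂f/∂x')`, `r` and `∫ r ∂f/∂(t, θ)` from the current to the final
time, where `r` solves the second order adjoint problem (`SONODE.hasFDerivAt_loss`). The three
gradients are this formula for families in which one parameter varies: the parameter of `f` is part
of the state, and the parameters of `g` and `s` enter through the initial data.

The substitution `W = M' + M ∂f/∂x'` turns the multiplier equation and the adjoint equation into the
linear system `M' = W - M ∂f/∂x'`, `W' = M ∂f/∂x` with continuous coefficients. Existence of the
multipliers and uniqueness of `r` follow from the theory of linear ODEs on a compact interval.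
-/

/-! ### Linear ODEs on a compact interval -/

/-- A linear ODE with continuous coefficients has a solution on the whole interval. The
Picard-Lindelöf theorem needs a bounded vector field, so the field is multiplied with a cutoff that
equals `1` on the ball to which Grönwall's inequality confines the solution. -/
theorem exists_linear_ode_solution {U : Type*} [NormedAddCommGroup U] [NormedSpace ℝ U]
    [CompleteSpace U] {a b : ℝ} (hab : a ≤ b) {𝒜 : ℝ → U →L[ℝ] U}
    (h𝒜 : ContinuousOn 𝒜 (Icc a b)) (u₀ : U) :
    ∃ u : ℝ → U, u a = u₀ ∧ ∀ t ∈ Icc a b, HasDerivWithinAt u (𝒜 t (u t)) (Icc a b) t := by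
  obtain ⟨K₀, hK₀⟩ := isCompact_Icc.exists_bound_of_continuousOn h𝒜
  have hK₀0 : 0 ≤ K₀ := (norm_nonneg _).trans (hK₀ a (left_mem_Icc.2 hab))
  lift K₀ to NNReal using hK₀0 with K
  obtain ⟨R, hR⟩ : ∃ R : NNReal, (R : ℝ) = ‖u₀‖ * Real.exp (K * (b - a)) :=
    ⟨⟨_, by positivity⟩, rfl⟩
  obtain ⟨T, hT⟩ : ∃ T : NNReal, (T : ℝ) = b - a := ⟨⟨_, sub_nonneg.2 hab⟩, rfl⟩
  set χ : U → ℝ := fun x => max 0 (min 1 (R + 1 - ‖x‖)) with hχ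
  have χ_nonneg : ∀ x, 0 ≤ χ x := fun x => le_max_left _ _
  have χ_le : ∀ x, χ x ≤ 1 := fun x => max_le zero_le_one (min_le_left _ _)
  have χ_lip : ∀ x y, |χ x - χ y| ≤ ‖x - y‖ := fun x y => by
    have h1 := abs_max_sub_max_le_max 0 (min 1 (R + 1 - ‖x‖)) 0 (min 1 (R + 1 - ‖y‖))
    have h2 := abs_min_sub_min_le_max 1 (R + 1 - ‖x‖) 1 (R + 1 - ‖y‖)
    have h3 : |R + 1 - ‖x‖ - (R + 1 - ‖y‖)| = |‖x‖ - ‖y‖| := by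
      rw [← abs_neg]; congr 1; ring
    rw [sub_self, abs_zero] at h1 h2
    rw [h3] at h2
    exact ((h1.trans (max_le (abs_nonneg _) le_rfl)).trans
      (h2.trans (max_le (abs_nonneg _) le_rfl))).trans (abs_norm_sub_norm_le x y)
  have χ_one : ∀ x, ‖x‖ ≤ R → χ x = 1 := fun x hx => by
    simp only [hχ]
    rw [min_eq_left (by linarith), max_eq_right zero_le_one]
  have χ_bound : ∀ x, ‖χ x • x‖ ≤ R + 1 := fun x => by
    rw [norm_smul, Real.norm_of_nonneg (χ_nonneg x)]
    rcases le_total ‖x‖ (R + 1) with h | h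
    · exact (mul_le_of_le_one_left (norm_nonneg _) (χ_le x)).trans h
    · have : χ x = 0 := by
        simp only [hχ]
        exact max_eq_left ((min_le_right _ _).trans (by linarith))
      rw [this, zero_mul]
      positivity
  -- the field `𝒜 t (χ x • x)` is bounded by `K (R + 1)`, hence the radius `K (R + 1) T`
  have hPL : IsPicardLindelof (fun t x => 𝒜 t (χ x • x)) (⟨a, left_mem_Icc.2 hab⟩ : Icc a b) u₀
      (K * (R + 1) * T) 0 (K * (R + 1)) (K * (1 + (‖u₀‖₊ + K * (R + 1) * T))) := by
    refine ⟨fun t ht => LipschitzOnWith.of_dist_le_mul fun x hx y hy => ?_,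
      fun x _ => h𝒜.clm_apply continuousOn_const, fun t ht x _ => ?_, ?_⟩
    · have hy' : ‖y‖ ≤ ‖u₀‖ + K * (R + 1) * T := by
        have h1 : ‖y - u₀‖ ≤ K * (R + 1) * T := by simpa [dist_eq_norm] using hy
        have h2 := norm_le_norm_add_norm_sub' y u₀
        linarith
      have h1 : χ x • x - χ y • y = χ x • (x - y) + (χ x - χ y) • y := by
        rw [smul_sub, sub_smul]; abel
      have h2 : ‖χ x • x - χ y • y‖ ≤ ‖x - y‖ + ‖x - y‖ * ‖y‖ := by
        rw [h1]
        refine (norm_add_le _ _).trans (add_le_add ?_ ?_)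
        · rw [norm_smul, Real.norm_of_nonneg (χ_nonneg x)]
          exact mul_le_of_le_one_left (norm_nonneg _) (χ_le x)
        · rw [norm_smul]
          exact mul_le_mul_of_nonneg_right (χ_lip x y) (norm_nonneg _)
      rw [dist_eq_norm, dist_eq_norm, ← map_sub]
      push_cast
      calc ‖𝒜 t (χ x • x - χ y • y)‖ ≤ K * ‖χ x • x - χ y • y‖ :=
            (𝒜 t).le_of_opNorm_le (hK₀ t ht) _
        _ ≤ K * (‖x - y‖ + ‖x - y‖ * (‖u₀‖ + K * (R + 1) * T)) := by
            gcongr; exact h2.trans (by gcongr)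
        _ = K * (1 + (‖u₀‖ + K * (R + 1) * T)) * ‖x - y‖ := by ring
    · push_cast
      exact ((𝒜 t).le_of_opNorm_le (hK₀ t ht) _).trans (by gcongr; exact χ_bound x)
    · rw [sub_self, max_eq_left (sub_nonneg.2 hab)]
      push_cast
      rw [hT, sub_zero]
  obtain ⟨u, hu₀, hu⟩ := hPL.exists_eq_forall_mem_Icc_hasDerivWithinAt₀
  refine ⟨u, hu₀, fun t ht => ?_⟩
  -- the field with cutoff still grows at most linearly, so the cutoff is inactive along `u`
  have hgr := norm_le_gronwallBound_of_norm_deriv_right_le (δ := ‖u₀‖) (K := K) (ε := 0)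
    (fun t ht => (hu t ht).continuousWithinAt)
    (fun t ht => (hu t (Ico_subset_Icc_self ht)).mono_of_mem_nhdsWithin
      (Icc_mem_nhdsGE_of_mem ht)) (by rw [← hu₀]) (fun t ht => by
      rw [add_zero]
      refine ((𝒜 t).le_of_opNorm_le (hK₀ t (Ico_subset_Icc_self ht)) _).trans ?_
      gcongr
      rw [norm_smul, Real.norm_of_nonneg (χ_nonneg _)]
      exact mul_le_of_le_one_left (norm_nonneg _) (χ_le _)) t ht
  have hle : ‖u t‖ ≤ R := by
    rw [gronwallBound_ε0] at hgr
    refine hgr.trans ?_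
    rw [hR]
    gcongr
    exact ht.2
  simpa [χ_one _ hle] using hu t ht

/-- The terminal value problem, by time reversal. -/
theorem exists_linear_ode_solution_terminal {U : Type*} [NormedAddCommGroup U] [NormedSpace ℝ U]
    [CompleteSpace U] {a b : ℝ} (hab : a ≤ b) {𝒜 : ℝ → U →L[ℝ] U}
    (h𝒜 : ContinuousOn 𝒜 (Icc a b)) (u₁ : U) :
    ∃ u : ℝ → U, u b = u₁ ∧ ∀ t ∈ Icc a b, HasDerivWithinAt u (𝒜 t (u t)) (Icc a b) t := by
  have hmaps : MapsTo (fun t => a + b - t) (Icc a b) (Icc a b) := fun t ht =>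
    ⟨by linarith [ht.2], by linarith [ht.1]⟩
  obtain ⟨u, hu₁, hu⟩ := exists_linear_ode_solution hab (𝒜 := fun t => -𝒜 (a + b - t))
    (h𝒜.comp (by fun_prop) hmaps).neg u₁
  refine ⟨fun t => u (a + b - t), by simpa using hu₁, fun t ht => ?_⟩
  have h := (hu _ (hmaps ht)).scomp t
    (((hasDerivAt_id t).const_sub (a + b)).hasDerivWithinAt (s := Icc a b)) hmaps
  simpa [Function.comp_def] using h

theorem linear_ode_solution_unique {U : Type*} [NormedAddCommGroup U] [NormedSpace ℝ U]
    {a b : ℝ} {𝒜 : ℝ → U →L[ℝ] U} (h𝒜 : ContinuousOn 𝒜 (Icc a b)) {u w : ℝ → U}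
    (hu : ∀ t ∈ Icc a b, HasDerivWithinAt u (𝒜 t (u t)) (Icc a b) t)
    (hw : ∀ t ∈ Icc a b, HasDerivWithinAt w (𝒜 t (w t)) (Icc a b) t) (hb : u b = w b) :
    EqOn u w (Icc a b) := by
  obtain ⟨K, hK⟩ := isCompact_Icc.exists_bound_of_continuousOn h𝒜
  refine ODE_solution_unique_of_mem_Icc_left (v := fun t => 𝒜 t) (K := K.toNNReal)
    (s := fun _ => univ)
    (fun t ht => ?_) (fun t ht => (hu t ht).continuousWithinAt)
    (fun t ht => (hu t (Ioc_subset_Icc_self ht)).mono_of_mem_nhdsWithin (Icc_mem_nhdsLE_of_mem ht))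
    (fun _ _ => mem_univ _) (fun t ht => (hw t ht).continuousWithinAt)
    (fun t ht => (hw t (Ioc_subset_Icc_self ht)).mono_of_mem_nhdsWithin (Icc_mem_nhdsLE_of_mem ht))
    (fun _ _ => mem_univ _) hb
  refine LipschitzOnWith.of_dist_le_mul fun x _ y _ => ?_
  rw [dist_eq_norm, dist_eq_norm, ← map_sub]
  exact (𝒜 t).le_of_opNorm_le
    ((hK t (Ioc_subset_Icc_self ht)).trans (Real.le_coe_toNNReal K)) _

/-! ### Sensitivity of a terminal functional -/

section

variable {Y H : Type*} [NormedAddCommGroup Y] [NormedSpace ℝ Y]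
  [NormedAddCommGroup H] [NormedSpace ℝ H]

/-- A `C¹` map is differentiable uniformly on compact sets: the error of the linear
approximation at base points `y ∈ K` is small relative to the increment, uniformly in `y`. -/
theorem IsCompact.eventually_norm_sub_sub_fderiv_le {F : Y → Y} (hF : ContDiff ℝ 1 F) {K : Set Y}
    (hK : IsCompact K) {ε : ℝ} (hε : 0 < ε) :
    ∀ᶠ h in 𝓝 (0 : Y), ∀ y ∈ K, ‖F (y + h) - F y - fderiv ℝ F y h‖ ≤ ε * ‖h‖ := by
  refine hK.eventually_forall_of_forall_eventually fun y _ => ?_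
  have hstrict := (hF.contDiffAt (x := y)).hasStrictFDerivAt one_ne_zero
  have h1 := hstrict.isLittleO.def (half_pos hε)
  have hlim : Tendsto (fun q : Y × Y => (q.2 + q.1, q.2)) (𝓝 (0, y)) (𝓝 (y, y)) := by
    have : Continuous fun q : Y × Y => (q.2 + q.1, q.2) := by fun_prop
    simpa using this.tendsto (0, y)
  have h2 : ∀ᶠ q : Y × Y in 𝓝 (0, y), ‖fderiv ℝ F q.2 - fderiv ℝ F y‖ < ε / 2 := by
    have hc : Continuous fun q : Y × Y => ‖fderiv ℝ F q.2 - fderiv ℝ F y‖ :=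
      ((((hF.continuous_fderiv one_ne_zero).comp continuous_snd)).sub continuous_const).norm
    exact hc.continuousAt.eventually_lt continuousAt_const (by simpa using half_pos hε)
  filter_upwards [hlim.eventually h1, h2] with q hq1 hq2
  simp only [add_sub_cancel_left] at hq1
  have h3 : ‖(fderiv ℝ F q.2 - fderiv ℝ F y) q.1‖ ≤ ε / 2 * ‖q.1‖ :=
    (fderiv ℝ F q.2 - fderiv ℝ F y).le_of_opNorm_le hq2.le _
  have h4 : F (q.2 + q.1) - F q.2 - fderiv ℝ F q.2 q.1
      = (F (q.2 + q.1) - F q.2 - fderiv ℝ F y q.1) - (fderiv ℝ F q.2 - fderiv ℝ F y) q.1 := by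
    rw [sub_apply]; abel
  rw [h4]
  linarith [norm_sub_le (F (q.2 + q.1) - F q.2 - fderiv ℝ F y q.1)
    ((fderiv ℝ F q.2 - fderiv ℝ F y) q.1)]

/-- Trajectories depend on the parameter in a Lipschitz way at `η₀`, uniformly in time. The field is
only locally Lipschitz and nothing confines the perturbed trajectories in advance, so the bound is
obtained from the fencing theorem, which tests the growth only where the bound is attained. -/
theorem exists_eventually_norm_trajectory_sub_le {F : Y → Y} (hF : ContDiff ℝ 1 F) {a b : ℝ}
    {z : H → ℝ → Y} {η₀ : H}
    (hz : ∀ᶠ η in 𝓝 η₀, ∀ t ∈ Icc a b, HasDerivWithinAt (z η) (F (z η t)) (Icc a b) t)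
    (hz₀ : DifferentiableAt ℝ (fun η => z η a) η₀) :
    ∃ C, 0 ≤ C ∧ ∀ᶠ η in 𝓝 η₀, ∀ t ∈ Icc a b, ‖z η t - z η₀ t‖ ≤ C * ‖η - η₀‖ := by
  have hη₀ := hz.self_of_nhds
  have hcont : ContinuousOn (z η₀) (Icc a b) := fun t ht => (hη₀ t ht).continuousWithinAt
  have hcomp : IsCompact (z η₀ '' Icc a b) := isCompact_Icc.image_of_continuousOn hcont
  obtain ⟨M, hM⟩ := hcomp.exists_bound_of_continuousOn
    (hF.continuous_fderiv one_ne_zero).continuousOn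
  obtain ⟨ρ, hρ, hρF⟩ := Metric.eventually_nhds_iff.1
    (hcomp.eventually_norm_sub_sub_fderiv_le hF one_pos)
  obtain ⟨C₀, hC₀, hinit⟩ := hz₀.hasFDerivAt.isBigO_sub.exists_pos
  set N : ℝ := |M| + 2
  set C : ℝ := C₀ * Real.exp (N * |b - a|)
  have hN : 0 < N := by positivity
  have hC : 0 < C := by positivity
  refine ⟨C, hC.le, ?_⟩
  have hsmall : ∀ᶠ η in 𝓝 η₀, C * ‖η - η₀‖ < ρ := by
    have : ContinuousAt (fun η => C * ‖η - η₀‖) η₀ := by fun_prop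
    exact this.eventually_lt continuousAt_const (by simpa using hρ)
  filter_upwards [hz, hsmall, hinit.bound] with η hη hηρ hηi
  -- the fence `B` must be positive for the strict inequality, hence `η = η₀` is separate
  rcases eq_or_ne η η₀ with rfl | hne
  · simp
  have hpos : 0 < ‖η - η₀‖ := norm_pos_iff.2 (sub_ne_zero.2 hne)
  -- the rate `N = |M| + 2` exceeds the growth rate `|M| + 1` of the difference inside the tube
  set B : ℝ → ℝ := fun t => C₀ * ‖η - η₀‖ * Real.exp (N * (t - a)) with hB
  have hBpos : ∀ t, 0 < B t := fun t => by positivity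
  have hBd : ∀ t, HasDerivAt B (N * B t) t := fun t => by
    have h := ((((hasDerivAt_id t).sub_const a).const_mul N).exp).const_mul (C₀ * ‖η - η₀‖)
    refine h.congr_deriv ?_
    simp only [hB, id]; ring
  have hBle : ∀ t ∈ Icc a b, B t ≤ C * ‖η - η₀‖ := fun t ht => by
    have : Real.exp (N * (t - a)) ≤ Real.exp (N * |b - a|) := by
      gcongr
      exact (sub_le_sub_right ht.2 a).trans (le_abs_self _)
    calc B t ≤ C₀ * ‖η - η₀‖ * Real.exp (N * |b - a|) := by simp only [hB]; gcongr
      _ = C * ‖η - η₀‖ := by simp only [C]; ring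
  have hd : ∀ t ∈ Icc a b, HasDerivWithinAt (fun t => z η t - z η₀ t)
      (F (z η t) - F (z η₀ t)) (Icc a b) t := fun t ht => (hη t ht).sub (hη₀ t ht)
  have key := image_norm_le_of_norm_deriv_right_lt_deriv_boundary'
    (fun t ht => (hd t ht).continuousWithinAt)
    (fun t ht => (hd t (Ico_subset_Icc_self ht)).mono_of_mem_nhdsWithin
      (Icc_mem_nhdsGE_of_mem ht)) (B := B) (B' := fun t => N * B t)
    (by simpa [hB] using hηi) (fun t _ => (hBd t).continuousAt.continuousWithinAt)
    (fun t _ => (hBd t).hasDerivWithinAt) (fun t ht heq => ?_)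
  · exact fun t ht => (key ht).trans (hBle t ht)
  have htI := Ico_subset_Icc_self ht
  have hmem : z η₀ t ∈ z η₀ '' Icc a b := mem_image_of_mem _ htI
  have h1 := hρF (y := z η t - z η₀ t)
    (by rw [dist_zero_right, heq]; exact (hBle t htI).trans_lt hηρ) _ hmem
  rw [add_sub_cancel] at h1
  have h2 : ‖fderiv ℝ F (z η₀ t) (z η t - z η₀ t)‖ ≤ |M| * ‖z η t - z η₀ t‖ :=
    (fderiv ℝ F _).le_of_opNorm_le ((hM _ hmem).trans (le_abs_self M)) _
  have h3 := norm_add_le (F (z η t) - F (z η₀ t) - fderiv ℝ F (z η₀ t) (z η t - z η₀ t))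
    (fderiv ℝ F (z η₀ t) (z η t - z η₀ t))
  rw [sub_add_cancel] at h3
  rw [heq] at h1 h2
  have h4 : N * B t = |M| * B t + 2 * B t := by simp only [N]; ring
  linarith [hBpos t]

/-- The derivative of a terminal functional with respect to a parameter of the trajectory. If the
costate `p` solves `p' = -p DF` with `p b = Dℓ`, then the pairing of `p` with the difference of two
trajectories is constant up to an error that is small relative to `‖η - η₀‖`. No differentiability
of the flow is used. -/
theorem hasFDerivAt_endpoint_of_costate {F : Y → Y} (hF : ContDiff ℝ 1 F) {a b : ℝ} (hab : a ≤ b)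
    {z : H → ℝ → Y} {η₀ : H}
    (hz : ∀ᶠ η in 𝓝 η₀, ∀ t ∈ Icc a b, HasDerivWithinAt (z η) (F (z η t)) (Icc a b) t)
    {Z₀ : H →L[ℝ] Y} (hz₀ : HasFDerivAt (fun η => z η a) Z₀ η₀) {p : ℝ → Y →L[ℝ] ℝ}
    (hp : ∀ t ∈ Icc a b,
      HasDerivWithinAt p (-(p t).comp (fderiv ℝ F (z η₀ t))) (Icc a b) t)
    {ℓ : Y → ℝ} (hℓ : HasFDerivAt ℓ (p b) (z η₀ b)) :
    HasFDerivAt (fun η => ℓ (z η b)) ((p a).comp Z₀) η₀ := by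
  have hη₀ := hz.self_of_nhds
  obtain ⟨C, hC, hCz⟩ := exists_eventually_norm_trajectory_sub_le hF hz hz₀.differentiableAt
  have hcont : ContinuousOn (z η₀) (Icc a b) := fun t ht => (hη₀ t ht).continuousWithinAt
  have hcomp : IsCompact (z η₀ '' Icc a b) := isCompact_Icc.image_of_continuousOn hcont
  obtain ⟨M, hM⟩ := isCompact_Icc.exists_bound_of_continuousOn
    (f := p) (fun t ht => (hp t ht).continuousWithinAt)
  have hM0 : 0 ≤ M := (norm_nonneg _).trans (hM a (left_mem_Icc.2 hab))
  have hend : (fun η => z η b - z η₀ b) =O[𝓝 η₀] fun η => η - η₀ :=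
    Asymptotics.IsBigO.of_bound C (hCz.mono fun η h => h b (right_mem_Icc.2 hab))
  have hlim : Tendsto (fun η => z η b) (𝓝 η₀) (𝓝 (z η₀ b)) := by
    have h0 : Tendsto (fun η : H => η - η₀) (𝓝 η₀) (𝓝 0) := by
      have : Continuous fun η : H => η - η₀ := by fun_prop
      simpa using this.tendsto η₀
    exact tendsto_sub_nhds_zero_iff.1 (hend.trans_tendsto h0)
  have h1 : (fun η => ℓ (z η b) - ℓ (z η₀ b) - p b (z η b - z η₀ b)) =o[𝓝 η₀]
      fun η => η - η₀ := (hℓ.isLittleO.comp_tendsto hlim).trans_isBigO hend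
  have h2 : (fun η => p a (z η a - z η₀ a - Z₀ (η - η₀))) =o[𝓝 η₀] fun η => η - η₀ :=
    ((p a).isBigO_comp _ _).trans_isLittleO hz₀.isLittleO
  have h3 : (fun η => p b (z η b - z η₀ b) - p a (z η a - z η₀ a)) =o[𝓝 η₀]
      fun η => η - η₀ := by
    refine Asymptotics.IsLittleO.of_bound fun c hc => ?_
    have hD : 0 < M * C * (b - a) + 1 := by
      have := sub_nonneg.2 hab
      positivity
    set ε := c / (M * C * (b - a) + 1)
    have hε : 0 < ε := div_pos hc hD
    obtain ⟨ρ, hρ, hρF⟩ := Metric.eventually_nhds_iff.1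
      (hcomp.eventually_norm_sub_sub_fderiv_le hF hε)
    have hsmall : ∀ᶠ η in 𝓝 η₀, C * ‖η - η₀‖ < ρ := by
      have : ContinuousAt (fun η => C * ‖η - η₀‖) η₀ := by fun_prop
      exact this.eventually_lt continuousAt_const (by simpa using hρ)
    filter_upwards [hz, hsmall, hCz] with η hη hηρ hηC
    have hd : ∀ t ∈ Icc a b, HasDerivWithinAt (fun t => p t (z η t - z η₀ t))
        (p t (F (z η t) - F (z η₀ t) - fderiv ℝ F (z η₀ t) (z η t - z η₀ t)))
        (Icc a b) t := fun t ht => by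
      refine ((hp t ht).clm_apply ((hη t ht).sub (hη₀ t ht))).congr_deriv ?_
      simp only [neg_apply, ContinuousLinearMap.comp_apply, map_sub, Pi.sub_apply]
      abel
    have hbd : ∀ t ∈ Ico a b,
        ‖p t (F (z η t) - F (z η₀ t) - fderiv ℝ F (z η₀ t) (z η t - z η₀ t))‖
          ≤ M * (ε * (C * ‖η - η₀‖)) := fun t ht => by
      have htI := Ico_subset_Icc_self ht
      have h := hρF (y := z η t - z η₀ t)
        (by rw [dist_zero_right]; exact (hηC t htI).trans_lt hηρ) _ (mem_image_of_mem _ htI)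
      rw [add_sub_cancel] at h
      refine ((p t).le_of_opNorm_le (hM t htI) _).trans ?_
      gcongr
      exact h.trans (by gcongr; exact hηC t htI)
    have hmv := norm_image_sub_le_of_norm_deriv_le_segment' hd hbd b (right_mem_Icc.2 hab)
    refine hmv.trans ?_
    have : ε * (M * C * (b - a)) ≤ c := by
      have : ε * (M * C * (b - a) + 1) = c := div_mul_cancel₀ _ hD.ne'
      linarith
    calc M * (ε * (C * ‖η - η₀‖)) * (b - a) = ε * (M * C * (b - a)) * ‖η - η₀‖ := by ring
      _ ≤ c * ‖η - η₀‖ := by gcongr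
  refine HasFDerivAt.of_isLittleO (((h1.add h3).add h2).congr_left fun η => ?_)
  simp only [ContinuousLinearMap.comp_apply, map_sub]
  ring

end

/-! ### The adjoint equation -/

namespace SONODE

section

variable {E P : Type*} [NormedAddCommGroup E] [NormedSpace ℝ E]
  {f : E → E → ℝ → P → E} {θ : P} {x v : ℝ → E} {a b t : ℝ} {L : E → E → ℝ}

theorem hasDerivWithinAt_jacV {v' : E}
    (hfv : ContDiff ℝ 1 (fun z : E × E × ℝ => fderiv ℝ (fun w => f z.1 w z.2.2 θ) z.2.1))
    (hx : HasDerivWithinAt x (v t) (Icc a b) t) (hv : HasDerivWithinAt v v' (Icc a b) t) :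
    HasDerivWithinAt (jacV f θ x v)
      (fderiv ℝ (fun z : E × E × ℝ => fderiv ℝ (fun w => f z.1 w z.2.2 θ) z.2.1)
        (x t, v t, t) (v t, v', 1)) (Icc a b) t :=
  HasFDerivAt.comp_hasDerivWithinAt (f := fun τ => (x τ, v τ, τ)) t
    (hfv.differentiable one_ne_zero _).hasFDerivAt
    (hx.prodMk (hv.prodMk (hasDerivAt_id t).hasDerivWithinAt))

/-- The multiplier equation with the product rule carried out. -/
theorem IsMultiplier.hasDerivWithinAt_deriv (hab : a < b) {A A' : ℝ → E →L[ℝ] E}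
    (hA : IsMultiplier f a b θ x v A A') (ht : t ∈ Icc a b)
    (hV : DifferentiableOn ℝ (jacV f θ x v) (Icc a b)) :
    HasDerivWithinAt A' ((A t).comp (jacX f θ x v t) - (A' t).comp (jacV f θ x v t)
      - (A t).comp (derivWithin (jacV f θ x v) (Icc a b) t)) (Icc a b) t := by
  have h := ((hA.deriv_one t ht).clm_comp (hV t ht).hasDerivWithinAt).derivWithin
    (uniqueDiffOn_Icc hab t ht)
  have h2 := hA.deriv_two t ht
  rw [h] at h2
  exact h2.congr_deriv (by abel)

/-- The multiplier equation is linear with coefficients acting from the right, so it is inherited by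
the row combination `-(∂L/∂x) A - (∂L/∂x') B`. -/
theorem IsAdjointState.exists_solvesAdjointProblem (hab : a < b)
    (hV : DifferentiableOn ℝ (jacV f θ x v) (Icc a b)) {r : ℝ → E →L[ℝ] ℝ}
    (hr : IsAdjointState f L a b θ x v r) :
    ∃ r', SolvesAdjointProblem f L a b θ x v r r' := by
  obtain ⟨A, A', B, B', hA, hA0, hA1, hB, hB0, hB1, hr⟩ := hr
  have hb : b ∈ Icc a b := right_mem_Icc.2 hab.le
  -- left composition with a fixed row vector, differentiated
  have hcomp (ℓ : E →L[ℝ] ℝ) {M : ℝ → E →L[ℝ] E} {M' : E →L[ℝ] E} {t : ℝ}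
      (h : HasDerivWithinAt M M' (Icc a b) t) :
      HasDerivWithinAt (fun t => ℓ.comp (M t)) (ℓ.comp M') (Icc a b) t :=
    (((ContinuousLinearMap.compL ℝ E E ℝ) ℓ).hasFDerivAt.comp_hasDerivWithinAt t h)
  refine ⟨fun t => -(lossX L x v b).comp (A' t) - (lossV L x v b).comp (B' t),
    fun t ht => ?_, fun t ht => ?_, ?_, ?_⟩
  · exact ((hcomp _ (hA.deriv_one t ht)).neg.sub (hcomp _ (hB.deriv_one t ht))).congr hr (hr t ht)
  · refine ((hcomp _ (hA.hasDerivWithinAt_deriv hab ht hV)).neg.sub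
      (hcomp _ (hB.hasDerivWithinAt_deriv hab ht hV))).congr_deriv ?_
    rw [hr t ht]
    ext y
    simp
    ring
  · rw [hr b hb, hA0, hB0]; ext y; simp
  · rw [hA1, hB1]; ext y; simp

/-- The combination `r' + r ∂f/∂x'` is, up to sign, the costate of the position. Its derivative is
`r ∂f/∂x`, so that no time derivative of a Jacobian is left in the first order form. -/
theorem SolvesAdjointProblem.hasDerivWithinAt_momentum
    (hV : DifferentiableOn ℝ (jacV f θ x v) (Icc a b)) {r r' : ℝ → E →L[ℝ] ℝ}
    (hr : SolvesAdjointProblem f L a b θ x v r r') (ht : t ∈ Icc a b) :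
    HasDerivWithinAt (fun t => r' t + (r t).comp (jacV f θ x v t))
      ((r t).comp (jacX f θ x v t)) (Icc a b) t :=
  ((hr.deriv_two t ht).add
    ((hr.deriv_one t ht).clm_comp (hV t ht).hasDerivWithinAt)).congr_deriv (by abel)

end

section

variable {E P G H : Type*} [NormedAddCommGroup E] [NormedSpace ℝ E]
  [NormedAddCommGroup P] [NormedSpace ℝ P] [NormedAddCommGroup G] [NormedSpace ℝ G]
  [NormedAddCommGroup H] [NormedSpace ℝ H]

/-- The vector field `f`, as a function of the tuple `(x, v, t, θ)`. -/
def uncurried (f : E → E → ℝ → P → E) (z : E × E × ℝ × P) : E :=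
  f z.1 z.2.1 z.2.2.1 z.2.2.2

/-- The total derivative of `f` along the curve `(x, v)`, as a function of time. -/
noncomputable def jac (f : E → E → ℝ → P → E) (θ : P) (x v : ℝ → E) (t : ℝ) :
    E × E × ℝ × P →L[ℝ] E :=
  fderiv ℝ (uncurried f) (x t, v t, t, θ)

variable {f : E → E → ℝ → P → E} {θ : P} {x v : ℝ → E} {a b t : ℝ} {L : E → E → ℝ}

theorem jacX_eq (hf : ContDiff ℝ 1 (uncurried f)) :
    jacX f θ x v t = (jac f θ x v t).comp (.inl ℝ E (E × ℝ × P)) :=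
  ((hf.differentiable one_ne_zero _).hasFDerivAt.comp (x t)
    (hasFDerivAt_prodMk_left (x t) (v t, t, θ))).fderiv

theorem jacV_eq (hf : ContDiff ℝ 1 (uncurried f)) :
    jacV f θ x v t = (jac f θ x v t).comp
      ((ContinuousLinearMap.inr ℝ E (E × ℝ × P)).comp (.inl ℝ E (ℝ × P))) := by
  have h : HasFDerivAt (fun w : E => (x t, w, t, θ)) _ (v t) :=
    HasFDerivAt.comp (𝕜 := ℝ) (g := Prod.mk (x t)) (f := fun w : E => (w, t, θ)) (v t)
      (hasFDerivAt_prodMk_right (x t) (v t, t, θ))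
      (hasFDerivAt_prodMk_left (v t) (t, θ))
  exact ((hf.differentiable one_ne_zero _).hasFDerivAt.comp (v t) h).fderiv

theorem jacθ_eq (hf : ContDiff ℝ 1 (uncurried f)) :
    jacθ f θ x v t = ((jac f θ x v t).comp
      ((ContinuousLinearMap.inr ℝ E (E × ℝ × P)).comp (.inr ℝ E (ℝ × P)))).comp
        (.inr ℝ ℝ P) := by
  have h : HasFDerivAt (fun τ : P => (v t, t, τ)) _ θ :=
    HasFDerivAt.comp (𝕜 := ℝ) (g := Prod.mk (v t)) (f := Prod.mk t) θ
      (hasFDerivAt_prodMk_right (v t) (t, θ))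
      (hasFDerivAt_prodMk_right t θ)
  have h' : HasFDerivAt (fun τ : P => (x t, v t, t, τ)) _ θ :=
    HasFDerivAt.comp (g := Prod.mk (x t)) θ (hasFDerivAt_prodMk_right (x t) (v t, t, θ)) h
  exact ((hf.differentiable one_ne_zero _).hasFDerivAt.comp θ h').fderiv

theorem continuousOn_jac (hf : ContDiff ℝ 1 (uncurried f)) (hx : ContinuousOn x (Icc a b))
    (hv : ContinuousOn v (Icc a b)) : ContinuousOn (jac f θ x v) (Icc a b) :=
  (hf.continuous_fderiv one_ne_zero).comp_continuousOn
    (hx.prodMk (hv.prodMk (continuousOn_id.prodMk continuousOn_const)))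

theorem continuousOn_jacX (hf : ContDiff ℝ 1 (uncurried f)) (hx : ContinuousOn x (Icc a b))
    (hv : ContinuousOn v (Icc a b)) : ContinuousOn (jacX f θ x v) (Icc a b) := by
  simp only [funext fun t => jacX_eq (θ := θ) (x := x) (v := v) (t := t) hf]
  exact (continuousOn_jac hf hx hv).clm_comp continuousOn_const

theorem continuousOn_jacV (hf : ContDiff ℝ 1 (uncurried f)) (hx : ContinuousOn x (Icc a b))
    (hv : ContinuousOn v (Icc a b)) : ContinuousOn (jacV f θ x v) (Icc a b) := by
  simp only [funext fun t => jacV_eq (θ := θ) (x := x) (v := v) (t := t) hf]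
  exact (continuousOn_jac hf hx hv).clm_comp continuousOn_const

theorem continuousOn_jacθ (hf : ContDiff ℝ 1 (uncurried f)) (hx : ContinuousOn x (Icc a b))
    (hv : ContinuousOn v (Icc a b)) : ContinuousOn (jacθ f θ x v) (Icc a b) := by
  simp only [funext fun t => jacθ_eq (θ := θ) (x := x) (v := v) (t := t) hf]
  exact ((continuousOn_jac hf hx hv).clm_comp continuousOn_const).clm_comp continuousOn_const

/-- The operator of the first order form `M' = W - M V`, `W' = M X` of
`M'' = M X - (M V)'`, with `W = M' + M V`. -/
noncomputable def adjointOp (X V : E →L[ℝ] E) :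
    (E →L[ℝ] G) × (E →L[ℝ] G) →L[ℝ] (E →L[ℝ] G) × (E →L[ℝ] G) :=
  (ContinuousLinearMap.inl ℝ _ _).comp (.snd ℝ _ _ -
    ((ContinuousLinearMap.compL ℝ E E G).flip V).comp (.fst ℝ _ _)) +
  (ContinuousLinearMap.inr ℝ _ _).comp
    (((ContinuousLinearMap.compL ℝ E E G).flip X).comp (.fst ℝ _ _))

theorem adjointOp_apply (X V : E →L[ℝ] E) (u : (E →L[ℝ] G) × (E →L[ℝ] G)) :
    adjointOp X V u = (u.2 - u.1.comp V, u.1.comp X) := by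
  simp [adjointOp]

set_option synthInstance.maxHeartbeats 200000 in
theorem continuousOn_adjointOp {X V : ℝ → E →L[ℝ] E} {s : Set ℝ} (hX : ContinuousOn X s)
    (hV : ContinuousOn V s) : ContinuousOn (fun t => adjointOp (G := G) (X t) (V t)) s := by
  have h (Z : ℝ → E →L[ℝ] E) (hZ : ContinuousOn Z s) :
      ContinuousOn (fun t => (ContinuousLinearMap.compL ℝ E E G).flip (Z t)) s :=
    (ContinuousLinearMap.compL ℝ E E G).flip.continuous.comp_continuousOn hZ
  exact (continuousOn_const.clm_comp
    (continuousOn_const.sub ((h V hV).clm_comp continuousOn_const))).add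
    (continuousOn_const.clm_comp ((h X hX).clm_comp continuousOn_const))

/-- Multipliers exist for all terminal data: the pair `(M, M' + M ∂f/∂x')` solves a linear system
with continuous coefficients. -/
theorem exists_isMultiplier [CompleteSpace E] (hab : a < b) (hf : ContDiff ℝ 1 (uncurried f))
    (hx : ContinuousOn x (Icc a b)) (hv : ContinuousOn v (Icc a b))
    (hV : DifferentiableOn ℝ (jacV f θ x v) (Icc a b)) (M₁ N₁ : E →L[ℝ] E) :
    ∃ A A' : ℝ → E →L[ℝ] E, IsMultiplier f a b θ x v A A' ∧ A b = M₁ ∧ A' b = N₁ := by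
  obtain ⟨u, hub, hu⟩ := exists_linear_ode_solution_terminal hab.le
    (continuousOn_adjointOp (G := E) (continuousOn_jacX (θ := θ) hf hx hv)
      (continuousOn_jacV (θ := θ) hf hx hv)) (M₁, N₁ + M₁.comp (jacV f θ x v b))
  have h1 : ∀ t ∈ Icc a b, HasDerivWithinAt (fun t => (u t).1)
      ((u t).2 - (u t).1.comp (jacV f θ x v t)) (Icc a b) t := fun t ht => by
    have h := (ContinuousLinearMap.fst ℝ (E →L[ℝ] E) (E →L[ℝ] E)).hasFDerivAt.comp_hasDerivWithinAt
      t (hu t ht)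
    rwa [adjointOp_apply] at h
  have h2 : ∀ t ∈ Icc a b, HasDerivWithinAt (fun t => (u t).2)
      ((u t).1.comp (jacX f θ x v t)) (Icc a b) t := fun t ht => by
    have h := (ContinuousLinearMap.snd ℝ (E →L[ℝ] E) (E →L[ℝ] E)).hasFDerivAt.comp_hasDerivWithinAt
      t (hu t ht)
    rwa [adjointOp_apply] at h
  refine ⟨fun t => (u t).1, fun t => (u t).2 - (u t).1.comp (jacV f θ x v t),
    ⟨h1, fun t ht => (h2 t ht).sub ?_⟩, by simp [hub], by simp [hub]⟩
  exact ((h1 t ht).clm_comp (hV t ht).hasDerivWithinAt).differentiableWithinAt.hasDerivWithinAt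

theorem exists_isAdjointState [CompleteSpace E] (hab : a < b) (hf : ContDiff ℝ 1 (uncurried f))
    (hx : ContinuousOn x (Icc a b)) (hv : ContinuousOn v (Icc a b))
    (hV : DifferentiableOn ℝ (jacV f θ x v) (Icc a b)) :
    ∃ r, IsAdjointState f L a b θ x v r := by
  obtain ⟨A, A', hA, hA0, hA1⟩ := exists_isMultiplier hab hf hx hv hV 0 (.id ℝ E)
  obtain ⟨B, B', hB, hB0, hB1⟩ := exists_isMultiplier hab hf hx hv hV (-.id ℝ E) (jacV f θ x v b)
  exact ⟨_, A, A', B, B', hA, hA0, hA1, hB, hB0, hB1, fun t _ => rfl⟩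

/-- Two solutions `ρ` of the adjoint problem yield solutions `(ρ, ρ' + ρ ∂f/∂x')` of the same linear
first order system, with the same terminal value. -/
theorem SolvesAdjointProblem.eqOn (hf : ContDiff ℝ 1 (uncurried f))
    (hx : ContinuousOn x (Icc a b)) (hv : ContinuousOn v (Icc a b))
    (hV : DifferentiableOn ℝ (jacV f θ x v) (Icc a b)) {r r' ρ ρ' : ℝ → E →L[ℝ] ℝ}
    (hr : SolvesAdjointProblem f L a b θ x v r r')
    (hρ : SolvesAdjointProblem f L a b θ x v ρ ρ') : EqOn ρ r (Icc a b) := by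
  have hsys {σ σ' : ℝ → E →L[ℝ] ℝ} (hσ : SolvesAdjointProblem f L a b θ x v σ σ') :
      ∀ t ∈ Icc a b, HasDerivWithinAt (fun t => (σ t, σ' t + (σ t).comp (jacV f θ x v t)))
        (adjointOp (jacX f θ x v t) (jacV f θ x v t)
          (σ t, σ' t + (σ t).comp (jacV f θ x v t))) (Icc a b) t := fun t ht => by
    rw [adjointOp_apply]
    exact ((hσ.deriv_one t ht).prodMk (hσ.hasDerivWithinAt_momentum hV ht)).congr_deriv (by simp)
  have h := linear_ode_solution_unique
    (continuousOn_adjointOp (continuousOn_jacX hf hx hv) (continuousOn_jacV hf hx hv))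
    (hsys hρ) (hsys hr)
    (by simp [hr.terminal_value, hr.terminal_deriv, hρ.terminal_value, hρ.terminal_deriv])
  exact fun t ht => congrArg Prod.fst (h ht)

/-! ### The gradient of the loss -/

/-- The autonomous first order vector field `(v, f, 1, 0)` on tuples `(x, v, t, θ)`. -/
def extendedField (f : E → E → ℝ → P → E) (z : E × E × ℝ × P) : E × E × ℝ × P :=
  (z.2.1, uncurried f z, 1, 0)

theorem fderiv_comp_prodMk_left {g : E × G → H} {y : E} {z : G} (hg : DifferentiableAt ℝ g (y, z)) :
    fderiv ℝ (fun y' => g (y', z)) y = (fderiv ℝ g (y, z)).comp (.inl ℝ E G) :=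
  (HasFDerivAt.comp (f := fun y' => (y', z)) y hg.hasFDerivAt
    (hasFDerivAt_prodMk_left y z)).fderiv

theorem fderiv_comp_prodMk_right {g : E × G → H} {y : E} {z : G}
    (hg : DifferentiableAt ℝ g (y, z)) :
    fderiv ℝ (fun z' => g (y, z')) z = (fderiv ℝ g (y, z)).comp (.inr ℝ E G) :=
  (HasFDerivAt.comp (f := fun z' => (y, z')) z hg.hasFDerivAt
    (hasFDerivAt_prodMk_right y z)).fderiv

/-- The adjoint formula for the derivative of the terminal loss of a family of trajectories, indexed
by `η`, whose initial position, initial velocity and parameter of `f` all depend on `η`. -/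
theorem hasFDerivAt_loss (hab : a ≤ b) (hf : ContDiff ℝ 1 (uncurried f))
    {X V : H → ℝ → E} {Θ : H → P} {η₀ : H}
    (hX : ∀ᶠ η in 𝓝 η₀, ∀ t ∈ Icc a b, HasDerivWithinAt (X η) (V η t) (Icc a b) t)
    (hV : ∀ᶠ η in 𝓝 η₀, ∀ t ∈ Icc a b,
      HasDerivWithinAt (V η) (f (X η t) (V η t) t (Θ η)) (Icc a b) t)
    (hJ : DifferentiableOn ℝ (jacV f (Θ η₀) (X η₀) (V η₀)) (Icc a b))
    {X₀ V₀ : H →L[ℝ] E} {Θ' : H →L[ℝ] P} (hX₀ : HasFDerivAt (fun η => X η a) X₀ η₀)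
    (hV₀ : HasFDerivAt (fun η => V η a) V₀ η₀) (hΘ : HasFDerivAt Θ Θ' η₀)
    (hL : DifferentiableAt ℝ (fun z : E × E => L z.1 z.2) (X η₀ b, V η₀ b))
    {r r' : ℝ → E →L[ℝ] ℝ} (hr : SolvesAdjointProblem f L a b (Θ η₀) (X η₀) (V η₀) r r') :
    HasFDerivAt (fun η => L (X η b) (V η b))
      ((r a).comp V₀ - (r' a + (r a).comp (jacV f (Θ η₀) (X η₀) (V η₀) a)).comp X₀
        + (∫ t in a..b, (r t).comp (jacθ f (Θ η₀) (X η₀) (V η₀) t)).comp Θ') η₀ := by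
  have hxc : ContinuousOn (X η₀) (Icc a b) :=
    fun t ht => (hX.self_of_nhds t ht).continuousWithinAt
  have hvc : ContinuousOn (V η₀) (Icc a b) :=
    fun t ht => (hV.self_of_nhds t ht).continuousWithinAt
  have hrc : ContinuousOn r (Icc a b) := fun t ht => (hr.deriv_one t ht).continuousWithinAt
  set J := jac f (Θ η₀) (X η₀) (V η₀) with hJdef
  -- `q` is the costate of the pair `(t, θ)`; it vanishes at `b`, as the loss depends on neither
  set φ : ℝ → ℝ × P →L[ℝ] ℝ := fun t => (r t).comp ((J t).comp
    ((ContinuousLinearMap.inr ℝ E (E × ℝ × P)).comp (.inr ℝ E (ℝ × P)))) with hφ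
  have hφc : ContinuousOn φ (Icc a b) :=
    hrc.clm_comp ((continuousOn_jac hf hxc hvc).clm_comp continuousOn_const)
  have hφi : ∀ t ∈ Icc a b, IntervalIntegrable φ MeasureTheory.volume t b := fun t ht =>
    ContinuousOn.intervalIntegrable_of_Icc ht.2 (hφc.mono (Icc_subset_Icc_left ht.1))
  set q : ℝ → ℝ × P →L[ℝ] ℝ := fun t => ∫ τ in t..b, φ τ
  have hqd : ∀ t ∈ Icc a b, HasDerivWithinAt q (-φ t) (Icc a b) t := fun t ht => by
    have : Fact (t ∈ Icc a b) := ⟨ht⟩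
    exact intervalIntegral.integral_hasDerivWithinAt_left (hφi t ht)
      (hφc.stronglyMeasurableAtFilter_nhdsWithin measurableSet_Icc t) (hφc t ht)
  -- the projections of `(x, v, t, θ)` to `x`, `v` and `(t, θ)`
  set π₁ : E × E × ℝ × P →L[ℝ] E := .fst ℝ _ _
  set π₂ : E × E × ℝ × P →L[ℝ] E := (ContinuousLinearMap.fst ℝ _ _).comp (.snd ℝ _ _)
  set π₃ : E × E × ℝ × P →L[ℝ] ℝ × P := (ContinuousLinearMap.snd ℝ _ _).comp (.snd ℝ _ _)
  -- the costate of the position is `-m`, that of the velocity is `r`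
  set m : ℝ → E →L[ℝ] ℝ := fun t => r' t + (r t).comp (jacV f (Θ η₀) (X η₀) (V η₀) t) with hm
  have hF : ContDiff ℝ 1 (extendedField f) :=
    contDiff_snd.fst.prodMk (hf.prodMk (contDiff_const.prodMk contDiff_const))
  have hDF : ∀ z, fderiv ℝ (extendedField f) z = π₂.prod ((fderiv ℝ (uncurried f) z).prod 0) :=
    fun z => (π₂.hasFDerivAt.prodMk ((hf.differentiable one_ne_zero z).hasFDerivAt.prodMk
      (hasFDerivAt_const ((1 : ℝ), (0 : P)) z))).fderiv
  have hend := hasFDerivAt_endpoint_of_costate hF hab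
    (z := fun η t => (X η t, V η t, t, Θ η)) (η₀ := η₀)
    (Z₀ := X₀.prod (V₀.prod ((0 : H →L[ℝ] ℝ).prod Θ')))
    (p := fun t => -(m t).comp π₁ + (r t).comp π₂ + (q t).comp π₃)
    (ℓ := fun z => L z.1 z.2.1) ?_ ?_ ?_ ?_
  · refine hend.congr_fderiv ?_
    have hqa : (q a).comp (.inr ℝ ℝ P) =
        ∫ t in a..b, (r t).comp (jacθ f (Θ η₀) (X η₀) (V η₀) t) := by
      have := ((ContinuousLinearMap.compL ℝ P (ℝ × P) ℝ).flip
        (.inr ℝ ℝ P)).intervalIntegral_comp_comm (hφi a (left_mem_Icc.2 hab))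
      simp only [jacθ_eq hf]
      exact this.symm
    rw [← hqa]
    ext h
    simp [π₁, π₂, π₃, hm]
    ring
  · filter_upwards [hX, hV] with η h1 h2 t ht
    exact (h1 t ht).prodMk ((h2 t ht).prodMk
      ((hasDerivAt_id t).hasDerivWithinAt.prodMk (hasDerivWithinAt_const t _ (Θ η))))
  · exact hX₀.prodMk (hV₀.prodMk ((hasFDerivAt_const a η₀).prodMk hΘ))
  · intro t ht
    have h := ((((hr.hasDerivWithinAt_momentum hJ ht).clm_comp
      (hasDerivWithinAt_const t (Icc a b) π₁)).neg.add
      ((hr.deriv_one t ht).clm_comp (hasDerivWithinAt_const t (Icc a b) π₂))).add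
      ((hqd t ht).clm_comp (hasDerivWithinAt_const t (Icc a b) π₃)))
    refine h.congr_deriv ?_
    rw [hDF]
    refine ContinuousLinearMap.ext fun ⟨y, w, τ⟩ => ?_
    have hsplit : J t (y, w, τ) = J t (y, 0) + J t (0, w, 0) + J t (0, 0, τ) := by
      rw [← map_add, ← map_add]; simp
    have hJt : fderiv ℝ (uncurried f) (X η₀ t, V η₀ t, t, Θ η₀) = J t := rfl
    simp [π₁, π₂, π₃, hm, hφ, hJt, hsplit, jacX_eq hf, jacV_eq hf, ← hJdef]
    ring
  · have hq0 : q b = 0 := intervalIntegral.integral_same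
    have hLx := fderiv_comp_prodMk_left hL
    have hLv := fderiv_comp_prodMk_right hL
    simp only [← lossX.eq_def, ← lossV.eq_def] at hLx hLv
    have hℓ : HasFDerivAt (fun z : E × E × ℝ × P => L z.1 z.2.1) _
        (X η₀ b, V η₀ b, b, Θ η₀) :=
      HasFDerivAt.comp (g := fun z : E × E => L z.1 z.2) (X η₀ b, V η₀ b, b, Θ η₀)
        hL.hasFDerivAt (π₁.prod π₂).hasFDerivAt
    refine hℓ.congr_fderiv ?_
    have hmb : m b = -lossX L (X η₀) (V η₀) b := by
      simp [hm, hr.terminal_value, hr.terminal_deriv]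
    rw [hq0, hmb, hr.terminal_value, hLx, hLv]
    refine ContinuousLinearMap.ext fun ⟨y, w, τ⟩ => ?_
    have hsplit := map_add (fderiv ℝ (fun z : E × E => L z.1 z.2) (X η₀ b, V η₀ b)) (y, 0) (0, w)
    simp only [Prod.mk_add_mk, add_zero, zero_add] at hsplit
    simp [π₁, π₂, π₃, hsplit]

end

end SONODE

/-! ### The second order neural ODE -/

theorem proposition1 {d p q k : ℕ} {D : Type*}
    (f : EuclideanSpace ℝ (Fin d) → EuclideanSpace ℝ (Fin d) → ℝ → EuclideanSpace ℝ (Fin p) →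
      EuclideanSpace ℝ (Fin d))
    (g : EuclideanSpace ℝ (Fin d) → EuclideanSpace ℝ (Fin q) → EuclideanSpace ℝ (Fin d))
    (s : D → EuclideanSpace ℝ (Fin k) → EuclideanSpace ℝ (Fin d)) (X₀ : D)
    (L : EuclideanSpace ℝ (Fin d) → EuclideanSpace ℝ (Fin d) → ℝ)
    (t₀ tₙ : ℝ) (ht : t₀ < tₙ)
    (θf : EuclideanSpace ℝ (Fin p)) (θg : EuclideanSpace ℝ (Fin q)) (θs : EuclideanSpace ℝ (Fin k))
    -- the trajectory and its velocity, for each value of the parameters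
    (X V : EuclideanSpace ℝ (Fin p) → EuclideanSpace ℝ (Fin q) → EuclideanSpace ℝ (Fin k) →
      ℝ → EuclideanSpace ℝ (Fin d))
    (hXV : ∀ᶠ θ in 𝓝 (θf, θg, θs), SONODE.IsTrajectory f g s X₀ t₀ tₙ θ.1 θ.2.1 θ.2.2
      (X θ.1 θ.2.1 θ.2.2) (V θ.1 θ.2.1 θ.2.2))
    -- the trajectory at the given parameters
    (x v : ℝ → EuclideanSpace ℝ (Fin d)) (hx : x = X θf θg θs) (hv : v = V θf θg θs)
    (hf : ContDiff ℝ 1 (fun z : EuclideanSpace ℝ (Fin d) × EuclideanSpace ℝ (Fin d) × ℝ ×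
      EuclideanSpace ℝ (Fin p) => f z.1 z.2.1 z.2.2.1 z.2.2.2))
    (hfv : ContDiff ℝ 1 (fun z : EuclideanSpace ℝ (Fin d) × EuclideanSpace ℝ (Fin d) × ℝ =>
      fderiv ℝ (fun w => f z.1 w z.2.2 θf) z.2.1))
    (hg : DifferentiableAt ℝ (fun z : EuclideanSpace ℝ (Fin d) × EuclideanSpace ℝ (Fin q) =>
      g z.1 z.2) (x t₀, θg))
    (hs : DifferentiableAt ℝ (s X₀) θs)
    (hL : DifferentiableAt ℝ (fun z : EuclideanSpace ℝ (Fin d) × EuclideanSpace ℝ (Fin d) =>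
      L z.1 z.2) (x tₙ, v tₙ)) :
    -- the total time derivative of `∂f/∂x'` along the trajectory exists and is given by the chain
    -- rule with `x'' = f`
    (∀ t ∈ Icc t₀ tₙ, HasDerivWithinAt (SONODE.jacV f θf x v)
      (fderiv ℝ (fun z : EuclideanSpace ℝ (Fin d) × EuclideanSpace ℝ (Fin d) × ℝ =>
        fderiv ℝ (fun w => f z.1 w z.2.2 θf) z.2.1) (x t, v t, t) (v t, f (x t) (v t) t θf, 1))
      (Icc t₀ tₙ) t) ∧
    (∃ r, SONODE.IsAdjointState f L t₀ tₙ θf x v r) ∧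
    ∀ r, SONODE.IsAdjointState f L t₀ tₙ θf x v r →
      ∃ r', SONODE.SolvesAdjointProblem f L t₀ tₙ θf x v r r' ∧
        -- the ODE and the terminal conditions determine `r`
        (∀ ρ ρ', SONODE.SolvesAdjointProblem f L t₀ tₙ θf x v ρ ρ' → EqOn ρ r (Icc t₀ tₙ)) ∧
        -- the gradient in `θf`
        IntervalIntegrable (fun t => (r t).comp (SONODE.jacθ f θf x v t)) MeasureTheory.volume
          tₙ t₀ ∧
        HasFDerivAt (fun θ => L (X θ θg θs tₙ) (V θ θg θs tₙ))
          (-∫ t in tₙ..t₀, (r t).comp (SONODE.jacθ f θf x v t)) θf ∧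
        -- the gradient in `θg`
        HasFDerivAt (fun θ => L (X θf θ θs tₙ) (V θf θ θs tₙ))
          ((r t₀).comp (fderiv ℝ (fun θ => g (x t₀) θ) θg)) θg ∧
        -- the gradient in `θs`
        HasFDerivAt (fun θ => L (X θf θg θ tₙ) (V θf θg θ tₙ))
          (((r t₀).comp (fderiv ℝ (fun y => g y θg) (x t₀)) - r' t₀
            - (r t₀).comp (SONODE.jacV f θf x v t₀)).comp (fderiv ℝ (s X₀) θs)) θs := by
  subst hx hv
  set x := X θf θg θs
  set v := V θf θg θs
  have htraj : SONODE.IsTrajectory f g s X₀ t₀ tₙ θf θg θs x v := hXV.self_of_nhds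
  have hf' : ContDiff ℝ 1 (SONODE.uncurried f) := hf
  have hxc : ContinuousOn x (Icc t₀ tₙ) := fun t h => (htraj.velocity t h).continuousWithinAt
  have hvc : ContinuousOn v (Icc t₀ tₙ) := fun t h => (htraj.acceleration t h).continuousWithinAt
  have hJ := fun t (h : t ∈ Icc t₀ tₙ) =>
    SONODE.hasDerivWithinAt_jacV hfv (htraj.velocity t h) (htraj.acceleration t h)
  have hJd : DifferentiableOn ℝ (SONODE.jacV f θf x v) (Icc t₀ tₙ) :=
    fun t h => (hJ t h).differentiableWithinAt
  refine ⟨hJ, SONODE.exists_isAdjointState ht hf' hxc hvc hJd, fun r hr => ?_⟩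
  obtain ⟨r', hr'⟩ := hr.exists_solvesAdjointProblem ht hJd
  have hrc : ContinuousOn r (Icc t₀ tₙ) := fun t h => (hr'.deriv_one t h).continuousWithinAt
  have hxs : x t₀ = s X₀ θs := htraj.initial_position
  refine ⟨r', hr', fun ρ ρ' hρ => hr'.eqOn hf' hxc hvc hJd hρ, ?_, ?_, ?_, ?_⟩
  · exact (ContinuousOn.intervalIntegrable_of_Icc ht.le
      (hrc.clm_comp (SONODE.continuousOn_jacθ hf' hxc hvc))).symm
  · have hev : ∀ᶠ θ in 𝓝 θf, SONODE.IsTrajectory f g s X₀ t₀ tₙ θ θg θs (X θ θg θs)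
        (V θ θg θs) :=
      (Continuous.tendsto (f := fun θ => (θ, θg, θs)) (by fun_prop) θf).eventually hXV
    have h := SONODE.hasFDerivAt_loss (X := fun θ => X θ θg θs) (V := fun θ => V θ θg θs)
      (Θ := fun θ => θ) (η₀ := θf) ht.le hf'
      (hev.mono fun θ h => h.velocity) (hev.mono fun θ h => h.acceleration) hJd
      (X₀ := 0) (V₀ := 0)
      ((hasFDerivAt_const (s X₀ θs) θf).congr_of_eventuallyEq
        (hev.mono fun θ h => h.initial_position))
      ((hasFDerivAt_const (g (s X₀ θs) θg) θf).congr_of_eventuallyEq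
        (hev.mono fun θ h => by
          simp only [h.initial_velocity, h.initial_position]))
      (hasFDerivAt_id θf) hL hr'
    refine h.congr_fderiv ?_
    -- the integral in the statement runs from `tₙ` to `t₀`, which accounts for its sign
    rw [intervalIntegral.integral_symm tₙ t₀]
    simp [x, v]
  · have hev : ∀ᶠ θ in 𝓝 θg, SONODE.IsTrajectory f g s X₀ t₀ tₙ θf θ θs (X θf θ θs)
        (V θf θ θs) :=
      (Continuous.tendsto (f := fun θ => (θf, θ, θs)) (by fun_prop) θg).eventually hXV
    have h := SONODE.hasFDerivAt_loss (X := fun θ => X θf θ θs) (V := fun θ => V θf θ θs)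
      (Θ := fun _ => θf) (η₀ := θg) ht.le hf'
      (hev.mono fun θ h => h.velocity) (hev.mono fun θ h => h.acceleration) hJd
      (X₀ := 0) (V₀ := fderiv ℝ (fun θ => g (x t₀) θ) θg)
      ((hasFDerivAt_const (s X₀ θs) θg).congr_of_eventuallyEq
        (hev.mono fun θ h => h.initial_position))
      (((hg.comp θg (by fun_prop : DifferentiableAt ℝ (fun θ => (x t₀, θ)) θg)).hasFDerivAt :
        HasFDerivAt (fun θ => g (x t₀) θ) _ θg).congr_of_eventuallyEq
        (hev.mono fun θ h => by
          simp only [h.initial_velocity, h.initial_position, hxs, Function.comp_apply]))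
      (hasFDerivAt_const θf θg) hL hr'
    refine h.congr_fderiv ?_
    simp
  · have hev : ∀ᶠ θ in 𝓝 θs, SONODE.IsTrajectory f g s X₀ t₀ tₙ θf θg θ (X θf θg θ)
        (V θf θg θ) :=
      (Continuous.tendsto (f := fun θ => (θf, θg, θ)) (by fun_prop) θs).eventually hXV
    -- the initial velocity depends on `θs` through the initial position
    have hgx : HasFDerivAt (fun y => g y θg) (fderiv ℝ (fun y => g y θg) (x t₀)) (s X₀ θs) := by
      rw [← hxs]
      exact (hg.comp (x t₀)
        (by fun_prop : DifferentiableAt ℝ (fun y => (y, θg)) (x t₀))).hasFDerivAt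
    have h := SONODE.hasFDerivAt_loss (X := fun θ => X θf θg θ) (V := fun θ => V θf θg θ)
      (Θ := fun _ => θf) (η₀ := θs) ht.le hf'
      (hev.mono fun θ h => h.velocity) (hev.mono fun θ h => h.acceleration) hJd
      (hs.hasFDerivAt.congr_of_eventuallyEq (hev.mono fun θ h => h.initial_position))
      ((hgx.comp θs hs.hasFDerivAt).congr_of_eventuallyEq
        (hev.mono fun θ h => by
          simp only [h.initial_velocity, h.initial_position, Function.comp_apply]))
      (hasFDerivAt_const θf θs) hL hr'
    refine h.congr_fderiv ?_
    ext y
    simp [x, v]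
    ring
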